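/- Let $G$ be a connected finite simple graph of order $n\ge 3$ with minimum degree $\delta$, and let $0=\sigma_0\le\sigma_1\le\cdots\le\sigma_{n-1}$ be its Laplacian eigenvalues, i.e. the eigenvalues, listed in increasing order with multiplicity, of $L(G)=D(G)-A(G)$, where $D(G)$ is the diagonal matrix of vertex degrees and $A(G)$ is the adjacency matrix of $G$. If $$\sigma_1\ \ge\ \frac{\sigma_{n-1}-\delta}{\sigma_{n-1}}\,n ,$$ then $G$ is Hamiltonian, i.e. $G$ has a cycle passing through every vertex. -/

import Mathlib

/-- The Laplacian eigenvalues of a finite simple graph `G` on `n` vertices, i.e. the eigenvalues of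
`L(G) = D(G) - A(G)` over `ℝ`, repeated according to multiplicity and listed in increasing order
`σ 0 ≤ σ 1 ≤ ⋯ ≤ σ (n - 1)`.  (Mathlib's `eigenvalues₀` lists them in decreasing order, hence
`Fin.rev`.) -/
noncomputable def laplacianEigenvalue {V : Type*} [Fintype V] [DecidableEq V]
    (G : SimpleGraph V) [DecidableRel G.Adj] (i : Fin (Fintype.card V)) : ℝ :=
  (G.isHermitian_lapMatrix ℝ).eigenvalues₀ i.rev

/-- The Laplacian eigenvalues are listed in increasing order. -/
theorem laplacianEigenvalue_mono {V : Type*} [Fintype V] [DecidableEq V]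
    (G : SimpleGraph V) [DecidableRel G.Adj] : Monotone (laplacianEigenvalue G) :=
  fun _ _ hij => (G.isHermitian_lapMatrix ℝ).eigenvalues₀_antitone (Fin.rev_le_rev.mpr hij)

/-! This is Chvátal–Erdős with `c` = σ₁ between the independence number and the connectivity.
Testing the quadratic form of L on suitable vectors shows that every vertex cut has at least σ₁
vertices (`Connected.laplacianEigenvalue_one_le_card`) and every nonempty independent set at most
n(σₙ₋₁ - δ)/σₙ₋₁ (`card_mul_minDegree_le_of_isIndepSet`), hence at most σ₁ by hypothesis. If a
longest cycle misses a vertex h, let H be the component of h off the cycle and S the set of its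
neighbours on the cycle. S is a cut, so c ≤ |S|; the cycle successors of S together with h are
independent, so |S| + 1 ≤ c. -/

open Finset Matrix

/-! ### Quadratic forms in a sorted eigenbasis -/

namespace Matrix.IsHermitian

/-- The eigenvector belonging to the `k`-th eigenvalue in decreasing order. -/
noncomputable def sortedEigenvector {ι : Type*} [Fintype ι] [DecidableEq ι] {A : Matrix ι ι ℝ}
    (hA : A.IsHermitian) (k : Fin (Fintype.card ι)) : ι → ℝ :=
  WithLp.ofLp (hA.eigenvectorBasis (Fintype.equivOfCardEq (Fintype.card_fin _) k))

variable {ι : Type*} [Fintype ι] [DecidableEq ι] {A : Matrix ι ι ℝ}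

lemma mulVec_sortedEigenvector (hA : A.IsHermitian) (k : Fin (Fintype.card ι)) :
    A *ᵥ hA.sortedEigenvector k = hA.eigenvalues₀ k • hA.sortedEigenvector k := by
  have := hA.mulVec_eigenvectorBasis (Fintype.equivOfCardEq (Fintype.card_fin _) k)
  simpa [sortedEigenvector, eigenvalues] using this

lemma sum_sq_dotProduct_sortedEigenvector (hA : A.IsHermitian) (x : ι → ℝ) :
    ∑ k, (hA.sortedEigenvector k ⬝ᵥ x) ^ 2 = x ⬝ᵥ x := by
  have h := hA.eigenvectorBasis.sum_sq_norm_inner_right (WithLp.toLp 2 x)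
  rw [EuclideanSpace.real_norm_sq_eq] at h
  rw [← (Fintype.equivOfCardEq (Fintype.card_fin (Fintype.card ι)) : _ ≃ ι).sum_comp] at h
  simp only [dotProduct, sortedEigenvector]
  simpa [PiLp.inner_apply, mul_comm, pow_two] using h

lemma sum_eigenvalues_mul_sq_dotProduct (hA : A.IsHermitian) (x : ι → ℝ) :
    ∑ k, hA.eigenvalues₀ k * (hA.sortedEigenvector k ⬝ᵥ x) ^ 2 = x ⬝ᵥ A *ᵥ x := by
  have h := hA.eigenvectorBasis.sum_inner_mul_inner (WithLp.toLp 2 x) (WithLp.toLp 2 (A *ᵥ x))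
  rw [← (Fintype.equivOfCardEq (Fintype.card_fin (Fintype.card ι)) : _ ≃ ι).sum_comp] at h
  have key (k) : hA.sortedEigenvector k ⬝ᵥ A *ᵥ x
      = hA.eigenvalues₀ k * (hA.sortedEigenvector k ⬝ᵥ x) := by
    rw [dotProduct_mulVec, ← mulVec_transpose, show Aᵀ = A by simpa using hA.eq,
      mulVec_sortedEigenvector, smul_dotProduct, smul_eq_mul]
  have h2 : ∑ k, (hA.sortedEigenvector k ⬝ᵥ x) * (hA.sortedEigenvector k ⬝ᵥ A *ᵥ x)
      = x ⬝ᵥ A *ᵥ x := by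
    simp only [EuclideanSpace.inner_eq_star_dotProduct, star_trivial] at h
    rw [dotProduct_comm x, ← h]
    refine Finset.sum_congr rfl fun k _ => ?_
    rw [dotProduct_comm (A *ᵥ x)]
    rfl
  rw [← h2]
  refine Finset.sum_congr rfl fun k _ => ?_
  rw [key]; ring

lemma dotProduct_mulVec_le (hA : A.IsHermitian) {c : ℝ} (hc : ∀ k, hA.eigenvalues₀ k ≤ c)
    (x : ι → ℝ) : x ⬝ᵥ A *ᵥ x ≤ c * (x ⬝ᵥ x) := by
  rw [← hA.sum_eigenvalues_mul_sq_dotProduct, ← hA.sum_sq_dotProduct_sortedEigenvector,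
    Finset.mul_sum]
  exact Finset.sum_le_sum fun k _ => mul_le_mul_of_nonneg_right (hc k) (sq_nonneg _)

/-- Eigenvectors orthogonal to `x` contribute nothing to the spectral expansion, so only the other
eigenvalues need the bound. -/
lemma le_dotProduct_mulVec (hA : A.IsHermitian) {c : ℝ} (x : ι → ℝ)
    (hc : ∀ k, hA.sortedEigenvector k ⬝ᵥ x = 0 ∨ c ≤ hA.eigenvalues₀ k) :
    c * (x ⬝ᵥ x) ≤ x ⬝ᵥ A *ᵥ x := by
  rw [← hA.sum_eigenvalues_mul_sq_dotProduct, ← hA.sum_sq_dotProduct_sortedEigenvector,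
    Finset.mul_sum]
  refine Finset.sum_le_sum fun k _ => ?_
  rcases hc k with h | h
  · simp [h]
  · exact mul_le_mul_of_nonneg_right h (sq_nonneg _)

end Matrix.IsHermitian

/-! ### Laplacian bounds for vertex cuts and independent sets -/

namespace SimpleGraph

variable {V : Type*} [Fintype V] [DecidableEq V] {G : SimpleGraph V} [DecidableRel G.Adj]

lemma lapMatrix_mulVec_eq_sum_neighborFinset (x : V → ℝ) (v : V) :
    (G.lapMatrix ℝ *ᵥ x) v = ∑ w ∈ G.neighborFinset v, (x v - x w) := by
  rw [lapMatrix_mulVec_apply, Finset.sum_sub_distrib, Finset.sum_const, card_neighborFinset_eq_degree,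
    nsmul_eq_mul]

lemma sum_lapMatrix_mulVec (x : V → ℝ) : ∑ v, (G.lapMatrix ℝ *ᵥ x) v = 0 := by
  have : (fun _ => 1 : V → ℝ) ⬝ᵥ G.lapMatrix ℝ *ᵥ x = 0 := by
    rw [dotProduct_mulVec, ← mulVec_transpose, (isSymm_lapMatrix (R := ℝ) G).eq,
      lapMatrix_mulVec_const_eq_zero, zero_dotProduct]
  simpa [dotProduct] using this

lemma eigenvalues₀_lapMatrix_nonneg (k : Fin (Fintype.card V)) :
    0 ≤ (G.isHermitian_lapMatrix ℝ).eigenvalues₀ k := by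
  have h := (posSemidef_lapMatrix ℝ G).eigenvalues_nonneg
    (Fintype.equivOfCardEq (Fintype.card_fin _) k)
  simpa [IsHermitian.eigenvalues] using h

/-- L is singular, so 0 is an eigenvalue, and positive semidefiniteness makes it the least. -/
lemma laplacianEigenvalue_zero [Nonempty V] :
    laplacianEigenvalue G ⟨0, Fintype.card_pos⟩ = 0 := by
  have hdet := G.det_lapMatrix_eq_zero
  rw [(G.isHermitian_lapMatrix ℝ).det_eq_prod_eigenvalues, Finset.prod_eq_zero_iff] at hdet
  obtain ⟨i, -, hi⟩ := hdet
  refine le_antisymm ?_ (eigenvalues₀_lapMatrix_nonneg _)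
  rw [← show (G.isHermitian_lapMatrix ℝ).eigenvalues i = 0 by simpa using hi]
  refine (G.isHermitian_lapMatrix ℝ).eigenvalues₀_antitone (Fin.le_def.2 ?_)
  rw [Fin.val_rev]
  simp only
  omega

/-- In a connected graph, the quadratic form of the Laplacian is bounded below by the algebraic
connectivity on the orthogonal complement of the constant vectors. -/
lemma Connected.laplacianEigenvalue_one_mul_le (hconn : G.Connected) (h1 : 1 < Fintype.card V)
    {x : V → ℝ} (hx : ∑ v, x v = 0) :
    laplacianEigenvalue G ⟨1, h1⟩ * (x ⬝ᵥ x) ≤ x ⬝ᵥ G.lapMatrix ℝ *ᵥ x := by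
  have := hconn.nonempty
  have hA := G.isHermitian_lapMatrix ℝ
  refine hA.le_dotProduct_mulVec x fun k => ?_
  -- `eigenvalues₀` decreases, so this is the last index. Its eigenvector lies in the kernel, hence
  -- is constant by connectedness and orthogonal to `x`.
  by_cases hk : k = Fin.rev ⟨0, Fintype.card_pos⟩
  · left
    have h0 : hA.eigenvalues₀ k = 0 := hk ▸ laplacianEigenvalue_zero
    have hker := hA.mulVec_sortedEigenvector k
    rw [h0, zero_smul, lapMatrix_mulVec_eq_zero_iff_forall_reachable] at hker
    obtain ⟨v⟩ := this
    rw [dotProduct, Finset.sum_congr rfl fun w _ =>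
      congrArg (· * x w) (hker w v (hconn.preconnected w v)), ← Finset.mul_sum, hx, mul_zero]
  · right
    refine hA.eigenvalues₀_antitone (Fin.le_def.2 ?_)
    have hk' : (k : ℕ) ≠ _ := fun h => hk (Fin.ext h)
    rw [Fin.val_rev] at hk' ⊢
    simp only at hk' ⊢
    omega

/-- The algebraic connectivity is at most the size of any vertex cut. -/
theorem Connected.laplacianEigenvalue_one_le_card (hconn : G.Connected)
    (h1 : 1 < Fintype.card V) {A B S : Finset V} (hA : A.Nonempty) (hB : B.Nonempty)
    (hAB : Disjoint A B) (hcover : ∀ v, v ∈ A ∨ v ∈ B ∨ v ∈ S) (hAS : Disjoint A S)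
    (hBS : Disjoint B S) (hadj : ∀ a ∈ A, ∀ b ∈ B, ¬ G.Adj a b) :
    laplacianEigenvalue G ⟨1, h1⟩ ≤ #S := by
  have ha : (0 : ℝ) < #A := by exact_mod_cast hA.card_pos
  have hb : (0 : ℝ) < #B := by exact_mod_cast hB.card_pos
  -- The weights make `x` orthogonal to the constants.
  let x : V → ℝ := fun v => if v ∈ A then (#B : ℝ) else if v ∈ B then -(#A : ℝ) else 0
  have xA {v} (hv : v ∈ A) : x v = #B := if_pos hv
  have xB {v} (hv : v ∈ B) : x v = -#A := by
    simp only [x, if_neg (Finset.disjoint_right.1 hAB hv), if_pos hv]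
  have xS {v} (hv : v ∈ S) : x v = 0 := by
    simp only [x, if_neg (Finset.disjoint_right.1 hAS hv),
      if_neg (Finset.disjoint_right.1 hBS hv)]
  have hsum : ∑ v, x v = 0 := by
    have : ∀ v, x v = (if v ∈ A then (#B : ℝ) else 0) + (if v ∈ B then -(#A : ℝ) else 0) := by
      intro v
      by_cases h : v ∈ A
      · simp [x, h, Finset.disjoint_left.1 hAB h]
      · simp [x, h]
    simp only [this, Finset.sum_add_distrib, Finset.sum_ite_mem, Finset.univ_inter,
      Finset.sum_const, nsmul_eq_mul]
    ring
  have hpos : 0 < x ⬝ᵥ x := by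
    obtain ⟨a, haA⟩ := hA
    refine Finset.sum_pos' (fun v _ => mul_self_nonneg _) ⟨a, mem_univ _, ?_⟩
    rw [xA haA]; positivity
  have hub : x ⬝ᵥ G.lapMatrix ℝ *ᵥ x ≤ #S * (x ⬝ᵥ x) := by
    rw [dotProduct, dotProduct, Finset.mul_sum]
    refine Finset.sum_le_sum fun v _ => ?_
    rw [lapMatrix_mulVec_eq_sum_neighborFinset, Finset.mul_sum]
    -- No edge joins A to B, and `x` is constant on each of A, B, S, so only terms with `w ∈ S` can
    -- survive.
    calc ∑ w ∈ G.neighborFinset v, x v * (x v - x w)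
        ≤ ∑ w ∈ G.neighborFinset v, if w ∈ S then x v * x v else 0 := by
          refine Finset.sum_le_sum fun w hw => ?_
          rw [mem_neighborFinset] at hw
          rcases hcover w with hwA | hwB | hwS
          · rw [if_neg (Finset.disjoint_left.1 hAS hwA)]
            rcases hcover v with hv | hv | hv
            · rw [xA hv, xA hwA]; simp
            · exact absurd hw.symm (hadj w hwA v hv)
            · rw [xS hv]; simp
          · rw [if_neg (Finset.disjoint_left.1 hBS hwB)]
            rcases hcover v with hv | hv | hv
            · exact absurd hw (hadj v hv w hwB)
            · rw [xB hv, xB hwB]; simp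
            · rw [xS hv]; simp
          · rw [if_pos hwS, xS hwS, sub_zero]
      _ ≤ ∑ w, if w ∈ S then x v * x v else 0 :=
          Finset.sum_le_sum_of_subset_of_nonneg (subset_univ _) fun w _ _ => by
            split_ifs
            exacts [mul_self_nonneg _, le_rfl]
      _ = #S * (x v * x v) := by simp
  exact le_of_mul_le_mul_right ((hconn.laplacianEigenvalue_one_mul_le h1 hsum).trans hub) hpos

/-- The ratio bound for independent sets in terms of the Laplacian, in product form. -/
theorem card_mul_minDegree_le_of_isIndepSet {I : Finset V} (hI : G.IsIndepSet I)
    (hne : I.Nonempty) {c : ℝ} (hc : ∀ k, laplacianEigenvalue G k ≤ c) :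
    (Fintype.card V : ℝ) * G.minDegree ≤ c * (Fintype.card V - #I) := by
  have : Nonempty V := ⟨hne.choose⟩
  obtain ⟨n, hn⟩ : ∃ n : ℝ, n = (Fintype.card V : ℝ) := ⟨_, rfl⟩
  rw [← hn]
  have hn0 : 0 < n := by rw [hn]; exact_mod_cast Fintype.card_pos
  obtain ⟨a, ha⟩ : ∃ a : ℝ, a = (#I : ℝ) := ⟨_, rfl⟩
  rw [← ha]
  have ha0 : 0 < a := by rw [ha]; exact_mod_cast hne.card_pos
  -- This is n times the projection of the indicator of I orthogonal to the constants; centering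
  -- produces the factor n - a.
  let x : V → ℝ := fun v => (if v ∈ I then n else 0) - a
  have hxx : x ⬝ᵥ x = n * a * (n - a) := by
    have : ∀ v, x v * x v = (if v ∈ I then n * n - 2 * n * a else 0) + a * a := by
      intro v
      simp only [x]
      split_ifs <;> ring
    simp only [dotProduct, this, Finset.sum_add_distrib, Finset.sum_ite_mem, Finset.univ_inter,
      Finset.sum_const, nsmul_eq_mul, Finset.card_univ, ← hn, ← ha]
    ring
  have hlow : n * a * (n * G.minDegree) ≤ x ⬝ᵥ G.lapMatrix ℝ *ᵥ x := by
    have hL : x ⬝ᵥ G.lapMatrix ℝ *ᵥ x = ∑ v ∈ I, n * (G.lapMatrix ℝ *ᵥ x) v := by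
      simp only [dotProduct, x, sub_mul, Finset.sum_sub_distrib, ite_mul, zero_mul,
        Finset.sum_ite_mem, Finset.univ_inter, ← Finset.mul_sum]
      rw [sum_lapMatrix_mulVec]; simp
    rw [hL]
    calc n * a * (n * G.minDegree) = ∑ v ∈ I, n * (n * G.minDegree) := by
          rw [Finset.sum_const, nsmul_eq_mul, ← ha]; ring
      _ ≤ _ := by
          refine Finset.sum_le_sum fun v hv => mul_le_mul_of_nonneg_left ?_ hn0.le
          rw [lapMatrix_mulVec_eq_sum_neighborFinset]
          have : ∀ w ∈ G.neighborFinset v, x v - x w = n := by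
            intro w hw
            rw [mem_neighborFinset] at hw
            have hwI : w ∉ I := fun hwI => hI hv hwI hw.ne hw
            simp [x, hv, hwI]
          rw [Finset.sum_congr rfl this, Finset.sum_const, nsmul_eq_mul,
            card_neighborFinset_eq_degree, mul_comm]
          gcongr
          exact G.minDegree_le_degree v
  have hup : x ⬝ᵥ G.lapMatrix ℝ *ᵥ x ≤ c * (x ⬝ᵥ x) := by
    refine (G.isHermitian_lapMatrix ℝ).dotProduct_mulVec_le (fun k => ?_) x
    simpa [laplacianEigenvalue] using hc k.rev
  rw [hxx] at hup
  refine le_of_mul_le_mul_left (a := n * a) ?_ (by positivity)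
  linarith

end SimpleGraph

/-! ### Longest cycles and detours outside them -/

namespace SimpleGraph

/-- A list of distinct vertices, of length at least three, that traverses a cycle of `G`. -/
structure IsCycleList {V : Type*} (G : SimpleGraph V) (l : List V) : Prop where
  nodup : l.Nodup
  isChain : l.IsChain G.Adj
  three_le_length : 3 ≤ l.length
  adj_getLast_head : ∀ x ∈ l.getLast?, ∀ y ∈ l.head?, G.Adj x y

/-- `P` lists the vertices of a path of `G` from `u` to `v` that avoids `l`. -/
structure IsPathListAvoiding {V : Type*} (G : SimpleGraph V) (l P : List V) (u v : V) : Prop where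
  nodup : P.Nodup
  isChain : P.IsChain G.Adj
  head?_eq : P.head? = some u
  getLast?_eq : P.getLast? = some v
  disjoint : l.Disjoint P

variable {V : Type*} {G : SimpleGraph V} {l P : List V} {u v x y : V}

lemma IsPathListAvoiding.length_pos (hP : G.IsPathListAvoiding l P u v) : 0 < P.length := by
  rcases P with _ | ⟨a, P⟩
  · simpa using hP.head?_eq
  · simp

/-- The closing edge and the edge at the junction exchange roles. -/
lemma IsCycleList.append_comm {l₁ l₂ : List V} (h : G.IsCycleList (l₁ ++ l₂)) :
    G.IsCycleList (l₂ ++ l₁) := by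
  obtain ⟨h1, h2, h3, h4⟩ := h
  rcases l₁.eq_nil_or_concat' with rfl | ⟨s, a, rfl⟩
  · simpa using ⟨h1, h2, h3, h4⟩
  rcases l₂ with _ | ⟨b, t⟩
  · rw [List.append_nil] at h1 h2 h3 h4
    exact ⟨h1, h2, h3, h4⟩
  refine ⟨List.nodup_append_comm.1 h1, ?_, by simp at h3 ⊢; omega, ?_⟩
  · rw [List.isChain_append] at h2 ⊢
    refine ⟨h2.2.1, h2.1, fun x hx y hy => h4 x ?_ y ?_⟩
    · simpa using hx
    · cases s <;> simpa using hy
  · rw [List.isChain_append] at h2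
    intro x hx y hy
    exact h2.2.2 x (by rwa [← List.append_assoc, List.getLast?_concat] at *) y
      (by simpa using hy)

/-- A cycle list can be rotated so as to end in any of its vertices. -/
lemma IsCycleList.exists_isRotated (h : G.IsCycleList l) (hx : x ∈ l) :
    ∃ y l', G.IsCycleList (y :: (l' ++ [x])) ∧ l ~r (y :: (l' ++ [x])) := by
  obtain ⟨s, t, rfl⟩ := List.append_of_mem hx
  have hlen := h.three_le_length
  rw [List.append_cons] at h ⊢
  obtain ⟨y, l', hyl⟩ : ∃ y l', t ++ s = y :: l' := by
    cases hts : t ++ s with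
    | nil => simp_all
    | cons y l' => exact ⟨y, l', rfl⟩
  have heq : t ++ (s ++ [x]) = y :: (l' ++ [x]) := by
    rw [← List.append_assoc, hyl, List.cons_append]
  exact ⟨y, l', heq ▸ h.append_comm, heq ▸ List.isRotated_append⟩

/-- A graph of minimum degree at least two has a cycle. -/
lemma exists_isCycleList [Fintype V] [DecidableRel G.Adj] (hconn : G.Connected)
    (hdeg : ∀ v, 2 ≤ G.degree v) : ∃ l, G.IsCycleList l := by
  have hcyc : ¬ G.IsAcyclic := by
    intro hac
    obtain ⟨v⟩ := hconn.nonempty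
    obtain ⟨w, hw⟩ := (G.degree_pos_iff_exists_adj v).1 (by have := hdeg v; omega)
    have : Nontrivial V := ⟨v, w, hw.ne⟩
    obtain ⟨u, hu⟩ := IsTree.exists_vert_degree_one_of_nontrivial ⟨hconn, hac⟩
    have := hdeg u
    omega
  simp only [IsAcyclic, not_forall, not_not] at hcyc
  obtain ⟨v, c, hc⟩ := hcyc
  have hne := hc.not_nil
  refine ⟨c.support.tail, hc.support_nodup, c.isChain_adj_support.tail, ?_, ?_⟩
  · have := hc.three_le_length
    simpa
  · cases c with
    | nil => simp at hne
    | cons hadj p =>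
      intro x hx y hy
      rw [Walk.support_cons, List.tail_cons] at hx hy
      rw [List.head?_eq_some_head (Walk.support_ne_nil _), Walk.head_support] at hy
      rw [List.getLast?_eq_some_getLast (Walk.support_ne_nil _), Walk.getLast_support] at hx
      cases hx; cases hy
      exact hadj

variable [DecidableEq V]

/-- `formPerm` serves as the successor map along the cycle. -/
lemma _root_.List.formPerm_append_cons_cons {s t : List V} (h : (s ++ x :: y :: t).Nodup) :
    (s ++ x :: y :: t).formPerm x = y := by
  have := List.formPerm_apply_lt_getElem _ h s.length (by simp)
  simpa using this

/-- On a longest cycle, the endpoints of a path outside the cycle are not adjacent to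
consecutive vertices of the cycle. -/
lemma IsCycleList.not_adj_formPerm (h : G.IsCycleList l)
    (hmax : ∀ l', G.IsCycleList l' → l'.length ≤ l.length) (hP : G.IsPathListAvoiding l P u v)
    (hx : x ∈ l) (hxu : G.Adj x u) : ¬ G.Adj v (l.formPerm x) := by
  intro hv
  obtain ⟨y, l', hl', hr⟩ := h.exists_isRotated hx
  rw [List.formPerm_eq_of_isRotated h.nodup hr, List.formPerm_cons_concat_apply_last] at hv
  have hlen := hr.perm.length_eq
  have hpos := hP.length_pos
  -- The detour P replaces the edge from x to its successor y, giving a longer cycle.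
  suffices G.IsCycleList (y :: (l' ++ [x]) ++ P) by
    have := hmax _ this
    rw [List.length_append, ← hlen] at this
    omega
  have hthree := hl'.three_le_length
  refine ⟨hl'.nodup.append hP.nodup fun a ha => hP.disjoint (hr.mem_iff.2 ha), ?_,
    by rw [List.length_append]; omega, ?_⟩
  · rw [List.isChain_append]
    refine ⟨hl'.isChain, hP.isChain, fun a ha b hb => ?_⟩
    rw [hP.head?_eq] at hb
    rw [← List.cons_append, List.getLast?_concat] at ha
    cases ha; cases hb
    exact hxu
  · intro a ha b hb
    rw [List.getLast?_append, hP.getLast?_eq] at ha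
    cases ha; cases hb
    exact hv

/-- On a longest cycle, the successors of two vertices that are joined by a path outside the
cycle are not adjacent. -/
lemma IsCycleList.not_adj_formPerm_formPerm {z : V} (h : G.IsCycleList l)
    (hmax : ∀ l', G.IsCycleList l' → l'.length ≤ l.length) (hP : G.IsPathListAvoiding l P u v)
    (hx : x ∈ l) (hz : z ∈ l) (hxz : z ≠ x) (hzu : G.Adj z u) (hvx : G.Adj v x) :
    ¬ G.Adj (l.formPerm z) (l.formPerm x) := by
  intro hadj
  obtain ⟨y, l', hl', hr⟩ := h.exists_isRotated hx
  rw [List.formPerm_eq_of_isRotated h.nodup hr, List.formPerm_cons_concat_apply_last] at hadj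
  have hlen := hr.perm.length_eq
  have hpos := hP.length_pos
  have hz' : z ∈ y :: l' := by
    have := hr.mem_iff.1 hz
    rw [← List.cons_append, List.mem_append] at this
    exact this.resolve_right (by simpa using hxz)
  obtain ⟨s, t, hst⟩ := List.append_of_mem hz'
  obtain ⟨z', t', ht⟩ : ∃ z' t', t ++ [x] = z' :: t' := by cases t <;> simp
  have heq : y :: (l' ++ [x]) = s ++ z :: z' :: t' := by
    rw [← List.cons_append, hst, List.append_assoc, List.cons_append, ht]
  have hy : (s ++ [z]).head? = some y := by
    cases s <;> simp_all
  have hx' : (z' :: t').getLast? = some x := by rw [← ht]; simp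
  rw [heq] at hadj hl' hlen
  rw [List.formPerm_append_cons_cons hl'.nodup] at hadj
  have hperm : (s ++ [z] ++ P ++ (z' :: t').reverse).Perm (s ++ z :: z' :: t' ++ P) := by
    have h1 : (P ++ (z' :: t').reverse).Perm (z' :: t' ++ P) :=
      List.perm_append_comm.trans ((List.reverse_perm _).append_right _)
    simpa using (h1.append_left (s ++ [z]))
  have hthree := hl'.three_le_length
  -- Here y and z' are the successors of x and z. The longer cycle runs from y to z, through P to x,
  -- then backwards to z', and closes by the assumed edge z'y.
  suffices G.IsCycleList (s ++ [z] ++ P ++ (z' :: t').reverse) by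
    have := hmax _ this
    rw [hperm.length_eq, List.length_append, ← hlen] at this
    omega
  have hchain := hl'.isChain
  rw [List.append_cons, List.isChain_append] at hchain
  refine ⟨?_, ?_, by rw [hperm.length_eq, List.length_append]; omega, ?_⟩
  · rw [hperm.nodup_iff]
    exact hl'.nodup.append hP.nodup fun a ha => hP.disjoint (hr.mem_iff.2 (heq ▸ ha))
  · rw [List.isChain_append, List.isChain_append]
    refine ⟨⟨hchain.1, hP.isChain, fun a ha b hb => ?_⟩, ?_, fun a ha b hb => ?_⟩
    · rw [hP.head?_eq] at hb
      rw [List.getLast?_concat] at ha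
      cases ha; cases hb
      exact hzu
    · rw [List.isChain_reverse]
      exact hchain.2.1.imp fun _ _ hab => hab.symm
    · rw [List.getLast?_append, hP.getLast?_eq] at ha
      rw [List.head?_reverse, hx'] at hb
      cases ha; cases hb
      exact hvx
  · intro a ha b hb
    rw [List.getLast?_append, List.getLast?_reverse] at ha
    rw [List.append_assoc, List.head?_append, hy] at hb
    cases ha; cases hb
    exact hadj

lemma exists_isPathListAvoiding (w : G.Walk u v) (hw : ∀ a ∈ w.support, a ∉ l) :
    ∃ P, G.IsPathListAvoiding l P u v := by
  refine ⟨w.toPath.1.support, w.toPath.2.support_nodup, Walk.isChain_adj_support _, ?_, ?_,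
    fun a ha hb => hw a (w.support_toPath_subset_support hb) ha⟩
  · rw [List.head?_eq_some_head (Walk.support_ne_nil _), Walk.head_support]
  · rw [List.getLast?_eq_some_getLast (Walk.support_ne_nil _), Walk.getLast_support]

/-- A cycle list through all vertices yields a Hamiltonian cycle. -/
lemma IsCycleList.isHamiltonian [Fintype V] (h : G.IsCycleList l) (hall : ∀ v, v ∈ l) :
    G.IsHamiltonian := by
  intro _
  have hlen := h.three_le_length
  have hne : l ≠ [] := by rintro rfl; simp at hlen
  let p := Walk.ofSupport l hne h.isChain
  have hp : p.support = l := Walk.support_ofSupport _ _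
  have hpath : p.IsPath := Walk.IsPath.mk' (hp.symm ▸ h.nodup)
  have hadj : G.Adj (l.getLast hne) (l.head hne) :=
    h.adj_getLast_head _ (List.getLast?_eq_some_getLast hne) _ (List.head?_eq_some_head hne)
  have hplen : p.length = l.length - 1 := Walk.length_ofSupport _ _
  refine ⟨_, Walk.cons hadj p, ?_⟩
  rw [Walk.isHamiltonianCycle_iff_isCycle_and_support_count_tail_eq_one, Walk.cons_isCycle_iff]
  refine ⟨⟨hpath, fun he => ?_⟩, fun a => ?_⟩
  · have := hpath.length_eq_one_of_mem_edges (Sym2.eq_swap ▸ he)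
    omega
  · rw [Walk.support_cons, List.tail_cons, hp]
    exact List.count_eq_one_of_mem h.nodup (hall a)

end SimpleGraph

/-! ### The Chvátal–Erdős argument -/

namespace SimpleGraph

variable {V : Type*} [Fintype V] [DecidableEq V] {G : SimpleGraph V} [DecidableRel G.Adj]

/-- A form of the **Chvátal–Erdős theorem**: if a real number `c` bounds the size of every nonempty
independent set from above and that of every vertex cut from below, then `G` is Hamiltonian. -/
theorem isHamiltonian_of_card_isIndepSet_le_of_le_card_cut (hconn : G.Connected)
    (h3 : 3 ≤ Fintype.card V) {c : ℝ}
    (hindep : ∀ I : Finset V, I.Nonempty → G.IsIndepSet I → #I ≤ c)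
    (hcut : ∀ A B S : Finset V, A.Nonempty → B.Nonempty → Disjoint A B →
      (∀ v, v ∈ A ∨ v ∈ B ∨ v ∈ S) → Disjoint A S → Disjoint B S →
      (∀ a ∈ A, ∀ b ∈ B, ¬ G.Adj a b) → c ≤ #S) :
    G.IsHamiltonian := by
  classical
  -- A non-neighbour w of v gives an independent pair, so 2 ≤ c, while the neighbourhood of v is a
  -- cut, so c ≤ deg v. Otherwise deg v = n - 1.
  have hdeg : ∀ v, 2 ≤ G.degree v := by
    intro v
    by_cases hv : ∃ w, w ≠ v ∧ ¬ G.Adj v w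
    · obtain ⟨w, hwv, hvw⟩ := hv
      have h2 : ((#{v, w} : ℕ) : ℝ) ≤ c := by
        refine hindep {v, w} (by simp) ?_
        simp [IsIndepSet, Set.pairwise_pair, hvw, G.adj_comm w v]
      have hc := hcut {v} ({v} ∪ G.neighborFinset v)ᶜ (G.neighborFinset v) (by simp)
        ⟨w, by simp [hwv, hvw]⟩ (by simp) (fun u => by
          simp only [mem_singleton, mem_compl, mem_union]; tauto) (by simp)
        (disjoint_compl_left.mono_right subset_union_right) (by simp)
      rw [card_pair hwv.symm] at h2
      rw [card_neighborFinset_eq_degree] at hc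
      exact_mod_cast h2.trans hc
    · push Not at hv
      have : univ.erase v ⊆ G.neighborFinset v := fun w hw => by
        simpa using hv w (ne_of_mem_erase hw)
      have := card_le_card this
      rw [card_erase_of_mem (mem_univ v), card_univ, card_neighborFinset_eq_degree] at this
      omega
  obtain ⟨l, hl, hmax⟩ : ∃ l, G.IsCycleList l ∧ ∀ l', G.IsCycleList l' → l'.length ≤ l.length := by
    obtain ⟨l₀, hl₀⟩ := exists_isCycleList hconn hdeg
    obtain ⟨m, ⟨l, hl, rfl⟩, hm⟩ := Set.exists_max_image
      {m : ℕ | ∃ l, G.IsCycleList l ∧ l.length = m} id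
      ((Set.finite_Iic (Fintype.card V)).subset (by
        rintro _ ⟨l, hl, rfl⟩
        exact hl.nodup.length_le_card)) ⟨_, l₀, hl₀, rfl⟩
    exact ⟨l, hl, fun l' hl' => hm _ ⟨l', hl', rfl⟩⟩
  refine hl.isHamiltonian ?_
  by_contra! hall
  obtain ⟨h, hh⟩ := hall
  let H : Finset V := {x | ∃ w : G.Walk h x, ∀ a ∈ w.support, a ∉ l}
  let S : Finset V := {x ∈ l.toFinset | ∃ u ∈ H, G.Adj x u}
  have hhH : h ∈ H := by simpa [H] using ⟨Walk.nil, by simpa using hh⟩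
  have hHl : ∀ x ∈ H, x ∉ l := by
    intro x hx
    obtain ⟨w, hw⟩ := (mem_filter.1 hx).2
    exact hw x w.end_mem_support
  have hSmem : ∀ x, x ∈ S ↔ x ∈ l ∧ ∃ u ∈ H, G.Adj x u := fun x => by simp [S]
  have hstep : ∀ x ∈ H, ∀ y, G.Adj x y → y ∉ l → y ∈ H := by
    intro x hx y hxy hy
    obtain ⟨w, hw⟩ := (mem_filter.1 hx).2
    refine mem_filter.2 ⟨mem_univ _, w.concat hxy, fun a ha => ?_⟩
    rw [Walk.support_concat, List.mem_append, List.mem_singleton] at ha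
    rcases ha with ha | rfl
    exacts [hw a ha, hy]
  have hpath : ∀ u ∈ H, ∀ v ∈ H, ∃ P, G.IsPathListAvoiding l P u v := by
    intro u hu v hv
    obtain ⟨w, hw⟩ := (mem_filter.1 hu).2
    obtain ⟨w', hw'⟩ := (mem_filter.1 hv).2
    refine exists_isPathListAvoiding (w.reverse.append w') fun a ha => ?_
    rw [Walk.mem_support_append_iff, Walk.support_reverse, List.mem_reverse] at ha
    exact ha.elim (hw a) (hw' a)
  have hsucc : ∀ x ∈ S, ∀ v ∈ H, ¬ G.Adj v (l.formPerm x) := by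
    intro x hx v hv
    obtain ⟨hxl, u, hu, hxu⟩ := (hSmem x).1 hx
    obtain ⟨P, hP⟩ := hpath u hu v hv
    exact hl.not_adj_formPerm hmax hP hxl hxu
  let T : Finset V := S.image l.formPerm
  have hTl : ∀ y ∈ T, y ∈ l := by
    intro y hy
    obtain ⟨x, hx, rfl⟩ := mem_image.1 hy
    exact List.formPerm_apply_mem_of_mem ((hSmem x).1 hx).1
  have hTH : ∀ y ∈ T, ∀ v ∈ H, ¬ G.Adj v y := by
    intro y hy
    obtain ⟨x, hx, rfl⟩ := mem_image.1 hy
    exact hsucc x hx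
  have hhT : h ∉ T := fun hT => hh (hTl h hT)
  have hcard : #(insert h T) = #S + 1 := by
    rw [card_insert_of_notMem hhT, card_image_of_injective _ l.formPerm.injective]
  have hI : G.IsIndepSet (insert h T : Finset V) := by
    rw [IsIndepSet, coe_insert, Set.pairwise_insert]
    refine ⟨?_, fun y hy _ => ⟨hTH y hy h hhH, fun hyh => hTH y hy h hhH hyh.symm⟩⟩
    intro a ha b hb hab
    obtain ⟨z, hz, rfl⟩ := mem_image.1 (mem_coe.1 ha)
    obtain ⟨x, hx, rfl⟩ := mem_image.1 (mem_coe.1 hb)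
    obtain ⟨hzl, u, hu, hzu⟩ := (hSmem z).1 hz
    obtain ⟨hxl, v, hv, hxv⟩ := (hSmem x).1 hx
    obtain ⟨P, hP⟩ := hpath u hu v hv
    exact hl.not_adj_formPerm_formPerm hmax hP hxl hzl (fun h => hab (h ▸ rfl)) hzu hxv.symm
  have hupper := hindep _ (insert_nonempty h T) hI
  have hlower : c ≤ #S := by
    refine hcut H (H ∪ S)ᶜ S ⟨h, hhH⟩ ?_ (disjoint_compl_right.mono_left subset_union_left)
      (fun v => by simp only [mem_compl, mem_union]; tauto) ?_
      (disjoint_compl_left.mono_right subset_union_right) ?_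
    -- The far side of the cut is nonempty: the successor of a vertex of S is on the cycle but not
    -- in S.
    · have hB : ∀ y ∈ l, y ∉ S → (H ∪ S)ᶜ.Nonempty := fun y hy hyS =>
        ⟨y, by simpa using ⟨fun hyH => hHl y hyH hy, hyS⟩⟩
      rcases S.eq_empty_or_nonempty with hS | ⟨x, hx⟩
      · obtain ⟨y, hy⟩ := List.exists_mem_of_ne_nil l (by rintro rfl; simpa using hl.three_le_length)
        exact hB y hy (by simp [hS])
      · have hxT : l.formPerm x ∈ T := mem_image_of_mem _ hx
        refine hB _ (hTl _ hxT) fun hS => ?_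
        obtain ⟨-, u, hu, hxu⟩ := (hSmem _).1 hS
        exact hTH _ hxT u hu hxu.symm
    · exact Finset.disjoint_left.2 fun x hxH hxS => hHl x hxH ((hSmem x).1 hxS).1
    · intro a ha b hb hab
      rw [mem_compl, mem_union, not_or] at hb
      by_cases hbl : b ∈ l
      · exact hb.2 ((hSmem b).2 ⟨hbl, a, ha, hab.symm⟩)
      · exact hb.1 (hstep a ha b hab hbl)
  rw [hcard] at hupper
  push_cast at hupper
  linarith

end SimpleGraph

/-! ### Combining the eigenvalue bounds -/

theorem theorem3p4 {V : Type*} [Fintype V] [DecidableEq V]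
    (G : SimpleGraph V) [DecidableRel G.Adj] (n : ℕ) (hn : Fintype.card V = n) (hn3 : 3 ≤ n)
    (hconn : G.Connected)
    (hσ : (laplacianEigenvalue G ⟨n - 1, by omega⟩ - (G.minDegree : ℝ))
        / laplacianEigenvalue G ⟨n - 1, by omega⟩ * (n : ℝ)
      ≤ laplacianEigenvalue G ⟨1, by omega⟩) :
    G.IsHamiltonian := by
  subst hn
  have h1 : 1 < Fintype.card V := by omega
  have : Nontrivial V := Fintype.one_lt_card_iff_nontrivial.1 h1
  refine SimpleGraph.isHamiltonian_of_card_isIndepSet_le_of_le_card_cut hconn hn3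
    (c := laplacianEigenvalue G ⟨1, h1⟩) (fun I hne hI => le_trans ?_ hσ)
    fun A B S hA hB hAB hcover hAS hBS hadj =>
      hconn.laplacianEigenvalue_one_le_card h1 hA hB hAB hcover hAS hBS hadj
  have hmax := SimpleGraph.card_mul_minDegree_le_of_isIndepSet hI hne
    (c := laplacianEigenvalue G ⟨Fintype.card V - 1, by omega⟩)
    fun k => laplacianEigenvalue_mono G (Fin.le_def.2 (by simp only; omega))
  generalize laplacianEigenvalue G ⟨Fintype.card V - 1, _⟩ = σ at hmax ⊢
  have hδ : (0 : ℝ) < G.minDegree := by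
    exact_mod_cast hconn.preconnected.minDegree_pos_of_nontrivial
  have hn : (0 : ℝ) < Fintype.card V := by exact_mod_cast Fintype.card_pos
  have hI' : (0 : ℝ) ≤ Fintype.card V - #I := sub_nonneg.2 (by exact_mod_cast card_le_univ I)
  -- Since nδ > 0, the ratio bound itself forces σₙ₋₁ > 0, so the division is genuine.
  have hσ0 : 0 < σ := pos_of_mul_pos_left ((mul_pos hn hδ).trans_le hmax) hI'
  rw [div_mul_eq_mul_div, le_div_iff₀ hσ0]
  linarith
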